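/- Let $X$ be a topological space and let $\{U_\alpha\}_{\alpha\in S}$ be a family of subsets of $X$ which is excisive, in the sense that every finite subfamily is covered by the relative interiors of its members: for every finite $\theta\subseteq S$, with $U^\theta=\bigcup_{\alpha\in\theta}U_\alpha$, $$\bigcup_{\alpha\in\theta}U_\alpha=\bigcup_{\alpha\in\theta}\operatorname{int}_{U^\theta}(U_\alpha),$$ where $\operatorname{int}_{U^\theta}$ denotes the interior relative to the subspace $U^\theta$. Call a space $Y$ acyclic if $\tilde H_q(Y)=0$ for all $q\ge -1$, where $\tilde H_*(Y)$ is the reduced singular homology of $Y$ with integer coefficients, that is, the homology of the augmented singular chain complex $\cdots\to C_2\to C_1\to C_0\to\mathbb Z\to 0$ with $\mathbb Z$ in degree $-1$ (so an acyclic space is nonempty). Then for every integer $k\ge 0$ the following two conditions are equivalent: - ($A_k$) for every nonempty $\theta\subseteq S$ with at most $k+1$ elements, the intersection $\bigcap_{\alpha\in\theta}U_\alpha$ is acyclic; - ($B_k$) for every nonempty $\theta\subseteq S$ with at most $k+1$ elements, the union $\bigcup_{\alpha\in\theta}U_\alpha$ is acyclic. -/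

import Mathlib

open CategoryTheory CategoryTheory.Limits

universe u v

noncomputable section

namespace ExcisiveFamily

/-! ### Reduced singular homology -/

/-- The coefficients `ℤ`, placed in the universe of the space. -/
abbrev coeffZ : ModuleCat.{u} ℤ := ModuleCat.of ℤ (ULift.{u} ℤ)

/-- The singular chain complex `⋯ → C₂ → C₁ → C₀` of `Y` with integral coefficients. -/
abbrev singularChains (Y : TopCat.{u}) : ChainComplex (ModuleCat.{u} ℤ) ℕ :=
  (TopCat.toSSet.obj Y).chainComplex coeffZ

theorem singularChains_eq (Y : TopCat.{u}) : singularChains Y =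
    ((AlgebraicTopology.singularChainComplexFunctor (ModuleCat.{u} ℤ)).obj coeffZ).obj Y :=
  rfl

/-- The augmentation `C₀ → ℤ`, which sends every singular 0-simplex to `1`, that is, which is the
identity on each summand of `C₀ = ∐ ℤ` (one summand for each singular 0-simplex). -/
def augmentation (Y : TopCat.{u}) : (singularChains Y).X 0 ⟶ coeffZ :=
  ((TopCat.toSSet.obj Y).isColimitChainComplexXCofan (coeffZ : ModuleCat.{u} ℤ) 0).desc
    (Cofan.mk coeffZ fun _ => 𝟙 _)

theorem ι_augmentation (Y : TopCat.{u}) (x) :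
    (TopCat.toSSet.obj Y).ιChainComplex (n := 0) x ≫ augmentation Y = 𝟙 coeffZ :=
  ((TopCat.toSSet.obj Y).isColimitChainComplexXCofan (coeffZ : ModuleCat.{u} ℤ) 0).fac
    (Cofan.mk coeffZ fun _ => 𝟙 _) ⟨x⟩

theorem d_augmentation (Y : TopCat.{u}) :
    (singularChains Y).d 1 0 ≫ augmentation Y = 0 := by
  apply SSet.chainComplex_hom_ext
  intro x
  simp [Fin.sum_univ_two, Preadditive.add_comp, ι_augmentation]

/-- The augmented singular chain complex `⋯ → C₂ → C₁ → C₀ → ℤ`.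
The term `ℤ` sits in position `0` and `Cₙ` in position `n + 1`. -/
def reducedSingularChains (Y : TopCat.{u}) : ChainComplex (ModuleCat.{u} ℤ) ℕ :=
  (singularChains Y).augment (augmentation Y) (d_augmentation Y)

/-- The reduced singular homology groups of `Y`, with the index shifted by one:
`reducedHomology Y n` is the reduced group in degree `n - 1`, for `n - 1 ≥ -1`. -/
def reducedHomology (Y : TopCat.{u}) (n : ℕ) : ModuleCat.{u} ℤ :=
  (reducedSingularChains Y).homology n

/-- A subset `A` of a space, with the subspace topology, is acyclic if all its reduced singular
homology groups (in degrees `-1, 0, 1, …`) vanish. -/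
def IsAcyclic {X : Type u} [TopologicalSpace X] (A : Set X) : Prop :=
  ∀ n : ℕ, IsZero (reducedHomology (TopCat.of A) n)

/-! ### Families of sets -/

/-- The interior of `A` relative to `V`, as a subset of the ambient space. -/
def relInterior {X : Type u} [TopologicalSpace X] (V A : Set X) : Set X :=
  Subtype.val '' interior (Subtype.val ⁻¹' A : Set V)

/-- The union of the family is the union of the interiors of its members relative to it. -/
def CoveredByInteriors {X : Type u} [TopologicalSpace X] {S : Type v} (U : S → Set X) : Prop :=
  ⋃ a, U a = ⋃ a, relInterior (⋃ b, U b) (U a)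

/-- A family is excisive if each of its finite subfamilies is covered by the interiors of its
members, relative to the union of that subfamily. -/
def IsExcisive {X : Type u} [TopologicalSpace X] {S : Type v} (U : S → Set X) : Prop :=
  ∀ θ : Finset S, CoveredByInteriors fun a : θ => U a

/-- Condition `A_k`: all intersections of at least one and at most `k + 1` members are acyclic. -/
def ConditionA {X : Type u} [TopologicalSpace X] {S : Type v} (U : S → Set X) (k : ℕ) : Prop :=
  ∀ θ : Finset S, θ.Nonempty → θ.card ≤ k + 1 → IsAcyclic (⋂ a ∈ θ, U a)

/-- Condition `B_k`: all unions of at least one and at most `k + 1` members are acyclic. -/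
def ConditionB {X : Type u} [TopologicalSpace X] {S : Type v} (U : S → Set X) (k : ℕ) : Prop :=
  ∀ θ : Finset S, θ.Nonempty → θ.card ≤ k + 1 → IsAcyclic (⋃ a ∈ θ, U a)

end ExcisiveFamily

end

/-!
The argument takes place in the distributive lattice of families of singular simplices of `X` that
are stable under affine maps of standard simplices (`SimplexFamily`). Such a family `P` has an
augmented chain complex; call `P` acyclic if this complex is exact. The chains of `P ⊓ Q` are the
intersection, and those of `P ⊔ Q` the sum, of the chains of `P` and `Q`. The Mayer–Vietoris
argument therefore shows that if `P` and `Q` are acyclic, then `P ⊓ Q` is acyclic if and only if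
`P ⊔ Q` is (`SimplexFamily.Acyclic.sup`, `SimplexFamily.Acyclic.inf`).

Let `P a` be the family of the simplices in `U a`. The meet of the `P a` over a finite set `θ` is
the family of the simplices in the intersection of the `U a`. Their join is smaller than the family
of the simplices in the union, but by the theorem of small simplices (`acyclic_sup_iff`) the one is
acyclic if and only if the other is; this is where excision enters. The equivalence is thus a
statement about meets and joins in a distributive lattice: if all meets of nonempty subfamilies are
acyclic, so is the join, and dually. It is proved by induction on the number of members, with the
distributive law used to replace the members `P b` by `P a ⊓ P b` (`sup'_of_forall_inf'`).

The theorem of small simplices is proved by barycentric subdivision. Chains are indexed by the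
number of vertices, so that the augmentation is the boundary operator that leads to the single
simplex without vertices, and all formulas are uniform. Subdivision and its homotopy to the identity
are built on tuples of points by coning, and transferred to singular simplices by naturality.
`isAcyclic_iff` compares these explicit chains with Mathlib's singular chain complex.
-/

noncomputable section

namespace ExcisiveFamily

/-! ### Chains of tuples -/

/-- Augmented ordered chains on a set `K`, indexed by the number of vertices: the free abelian group
on the `n`-tuples of points of `K`. The empty tuple spans the term of degree `-1`. -/
abbrev TupleChains (K : Type*) (n : ℕ) := (Fin n → K) →₀ ℤ

namespace TupleChains

variable {K L : Type*}

/-- The boundary `∑ (-1)ⁱ (v₀, …, v̂ᵢ, …, vₙ)`. -/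
def boundary (n : ℕ) : TupleChains K (n + 1) →ₗ[ℤ] TupleChains K n :=
  Finsupp.linearCombination ℤ fun v =>
    ∑ i : Fin (n + 1), (-1 : ℤ) ^ (i : ℕ) • Finsupp.single (v ∘ i.succAbove) 1

/-- The cone with apex `b`: it puts the vertex `b` in front of every tuple. -/
def cone (b : K) (n : ℕ) : TupleChains K n →ₗ[ℤ] TupleChains K (n + 1) :=
  Finsupp.lmapDomain ℤ ℤ fun v => (Fin.cons b v : Fin (n + 1) → K)

/-- The chain map induced by a map of vertices. -/
def map (f : K → L) (n : ℕ) : TupleChains K n →ₗ[ℤ] TupleChains L n :=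
  Finsupp.lmapDomain ℤ ℤ fun v => f ∘ v

theorem boundary_single {n : ℕ} (v : Fin (n + 1) → K) :
    boundary n (Finsupp.single v 1) =
      ∑ i : Fin (n + 1), (-1 : ℤ) ^ (i : ℕ) • Finsupp.single (v ∘ i.succAbove) 1 := by
  simp [boundary]

@[simp]
theorem cone_single (b : K) {n : ℕ} (v : Fin n → K) :
    cone b n (Finsupp.single v 1) = Finsupp.single (Fin.cons b v : Fin (n + 1) → K) 1 := by
  simp [cone]

@[simp]
theorem map_single (f : K → L) {n : ℕ} (v : Fin n → K) :
    map f n (Finsupp.single v 1) = Finsupp.single (f ∘ v) 1 := by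
  simp [map]

theorem boundary_cone_zero (b : K) (c : TupleChains K 0) : boundary 0 (cone b 0 c) = c := by
  suffices h : boundary 0 ∘ₗ cone b 0 = LinearMap.id from LinearMap.congr_fun h c
  refine Finsupp.lhom_ext' fun v => LinearMap.ext_ring ?_
  simp [boundary_single, Subsingleton.elim _ v]

theorem boundary_cone (b : K) (n : ℕ) (c : TupleChains K (n + 1)) :
    boundary (n + 1) (cone b (n + 1) c) = c - cone b n (boundary n c) := by
  suffices h : boundary (n + 1) ∘ₗ cone b (n + 1) = LinearMap.id - cone b n ∘ₗ boundary n from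
    LinearMap.congr_fun h c
  refine Finsupp.lhom_ext' fun v => LinearMap.ext_ring ?_
  have h0 : (Fin.cons b v : Fin (n + 2) → K) ∘ Fin.succAbove 0 = v := by
    ext j; simp
  have h1 (i : Fin (n + 1)) : (Fin.cons b v : Fin (n + 2) → K) ∘ i.succ.succAbove =
      Fin.cons b (v ∘ i.succAbove) := by
    ext j
    refine Fin.cases ?_ (fun j => ?_) j <;> simp
  simp only [LinearMap.comp_apply, Finsupp.lsingle_apply, cone_single, boundary_single,
    LinearMap.sub_apply, LinearMap.id_apply, map_sum, map_smul]
  rw [Fin.sum_univ_succ, h0]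
  simp [h1, pow_succ, sub_eq_add_neg]

/-- Every nonempty tuple is the cone over its tail, so this follows from the cone formula by
induction, without a cancellation of double sums. -/
theorem boundary_boundary (n : ℕ) (c : TupleChains K (n + 2)) :
    boundary n (boundary (n + 1) c) = 0 := by
  induction n with
  | zero =>
    suffices h : boundary 0 ∘ₗ boundary 1 = (0 : TupleChains K 2 →ₗ[ℤ] _) from
      LinearMap.congr_fun h c
    refine Finsupp.lhom_ext' fun v => LinearMap.ext_ring ?_
    rw [LinearMap.comp_apply, Finsupp.lsingle_apply, ← Fin.cons_self_tail v, ← cone_single,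
      LinearMap.comp_apply, boundary_cone, map_sub, boundary_cone_zero, sub_self]
    rfl
  | succ n ih =>
    suffices h : boundary (n + 1) ∘ₗ boundary (n + 2) = (0 : TupleChains K (n + 3) →ₗ[ℤ] _) from
      LinearMap.congr_fun h c
    refine Finsupp.lhom_ext' fun v => LinearMap.ext_ring ?_
    rw [LinearMap.comp_apply, Finsupp.lsingle_apply, ← Fin.cons_self_tail v, ← cone_single,
      LinearMap.comp_apply, boundary_cone, map_sub, boundary_cone, ih, map_zero, sub_zero, sub_self]
    rfl

theorem map_cone (f : K → L) (b : K) (n : ℕ) (c : TupleChains K n) :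
    map f (n + 1) (cone b n c) = cone (f b) n (map f n c) := by
  suffices h : map f (n + 1) ∘ₗ cone b n = cone (f b) n ∘ₗ map f n from LinearMap.congr_fun h c
  refine Finsupp.lhom_ext' fun v => LinearMap.ext_ring ?_
  simp only [LinearMap.comp_apply, Finsupp.lsingle_apply, cone_single, map_single]
  congr 1
  ext j
  refine Fin.cases ?_ (fun j => ?_) j <;> simp

theorem map_boundary (f : K → L) (n : ℕ) (c : TupleChains K (n + 1)) :
    map f n (boundary n c) = boundary n (map f (n + 1) c) := by
  suffices h : map f n ∘ₗ boundary n = boundary n ∘ₗ map f (n + 1) from LinearMap.congr_fun h c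
  refine Finsupp.lhom_ext' fun v => LinearMap.ext_ring ?_
  simp only [LinearMap.comp_apply, Finsupp.lsingle_apply, boundary_single, map_sum, map_smul,
    map_single, Function.comp_assoc]

/-- The subdivision operator of tuple chains for a choice `b` of a centre of each nonempty tuple:
a tuple is replaced by the cone from its centre over the subdivision of its boundary. -/
def subdivision (b : ∀ n, (Fin (n + 1) → K) → K) : ∀ n, TupleChains K n →ₗ[ℤ] TupleChains K n
  | 0 => LinearMap.id
  | n + 1 => Finsupp.linearCombination ℤ fun v =>
      cone (b n v) n (subdivision b n (boundary n (Finsupp.single v 1)))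

/-- The chain homotopy from the identity to `subdivision b`. -/
def homotopy (b : ∀ n, (Fin (n + 1) → K) → K) : ∀ n, TupleChains K n →ₗ[ℤ] TupleChains K (n + 1)
  | 0 => 0
  | n + 1 => Finsupp.linearCombination ℤ fun v =>
      cone (b n v) (n + 1)
        (Finsupp.single v 1 - homotopy b n (boundary n (Finsupp.single v 1)))

variable (b : ∀ n, (Fin (n + 1) → K) → K)

theorem subdivision_zero (c : TupleChains K 0) : subdivision b 0 c = c := rfl

theorem subdivision_succ_single {n : ℕ} (v : Fin (n + 1) → K) :
    subdivision b (n + 1) (Finsupp.single v 1) =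
      cone (b n v) n (subdivision b n (boundary n (Finsupp.single v 1))) := by
  simp [subdivision]

theorem homotopy_zero (c : TupleChains K 0) : homotopy b 0 c = 0 := rfl

theorem homotopy_succ_single {n : ℕ} (v : Fin (n + 1) → K) :
    homotopy b (n + 1) (Finsupp.single v 1) = cone (b n v) (n + 1)
      (Finsupp.single v 1 - homotopy b n (boundary n (Finsupp.single v 1))) := by
  simp [homotopy]

theorem boundary_subdivision (n : ℕ) (c : TupleChains K (n + 1)) :
    boundary n (subdivision b (n + 1) c) = subdivision b n (boundary n c) := by
  induction n with
  | zero =>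
    suffices h : boundary 0 ∘ₗ subdivision b 1 = subdivision b 0 ∘ₗ boundary 0 from
      LinearMap.congr_fun h c
    refine Finsupp.lhom_ext' fun v => LinearMap.ext_ring ?_
    rw [LinearMap.comp_apply, Finsupp.lsingle_apply, LinearMap.comp_apply, subdivision_succ_single,
      boundary_cone_zero]
    rfl
  | succ n ih =>
    suffices h : boundary (n + 1) ∘ₗ subdivision b (n + 2) =
        subdivision b (n + 1) ∘ₗ boundary (n + 1) from LinearMap.congr_fun h c
    refine Finsupp.lhom_ext' fun v => LinearMap.ext_ring ?_
    rw [LinearMap.comp_apply, Finsupp.lsingle_apply, LinearMap.comp_apply, subdivision_succ_single,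
      boundary_cone, ih, boundary_boundary, map_zero, map_zero, sub_zero]
    rfl

theorem boundary_homotopy_zero (c : TupleChains K 0) :
    boundary 0 (homotopy b 0 c) = c - subdivision b 0 c := by
  simp [homotopy_zero, subdivision_zero]

theorem boundary_homotopy (n : ℕ) (c : TupleChains K (n + 1)) :
    boundary (n + 1) (homotopy b (n + 1) c) =
      c - subdivision b (n + 1) c - homotopy b n (boundary n c) := by
  induction n with
  | zero =>
    suffices h : boundary 1 ∘ₗ homotopy b 1 =
        LinearMap.id - subdivision b 1 - homotopy b 0 ∘ₗ boundary 0 from LinearMap.congr_fun h c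
    refine Finsupp.lhom_ext' fun v => LinearMap.ext_ring ?_
    simp only [LinearMap.comp_apply, Finsupp.lsingle_apply, LinearMap.sub_apply, LinearMap.id_apply,
      homotopy_succ_single, homotopy_zero, sub_zero, subdivision_succ_single, boundary_cone,
      subdivision_zero]
  | succ n ih =>
    suffices h : boundary (n + 2) ∘ₗ homotopy b (n + 2) =
        LinearMap.id - subdivision b (n + 2) - homotopy b (n + 1) ∘ₗ boundary (n + 1) from
      LinearMap.congr_fun h c
    refine Finsupp.lhom_ext' fun v => LinearMap.ext_ring ?_
    simp only [LinearMap.comp_apply, Finsupp.lsingle_apply, LinearMap.sub_apply, LinearMap.id_apply,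
      homotopy_succ_single, subdivision_succ_single, boundary_cone, map_sub, ih,
      boundary_boundary, map_zero]
    abel

variable {b} {b' : ∀ n, (Fin (n + 1) → L) → L} {f : K → L}

theorem map_subdivision (hf : ∀ n v, f (b n v) = b' n (f ∘ v)) (n : ℕ) (c : TupleChains K n) :
    map f n (subdivision b n c) = subdivision b' n (map f n c) := by
  induction n with
  | zero => rfl
  | succ n ih =>
    suffices h : map f (n + 1) ∘ₗ subdivision b (n + 1) =
        subdivision b' (n + 1) ∘ₗ map f (n + 1) from LinearMap.congr_fun h c
    refine Finsupp.lhom_ext' fun v => LinearMap.ext_ring ?_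
    simp only [LinearMap.comp_apply, Finsupp.lsingle_apply, subdivision_succ_single, map_cone, ih,
      map_boundary, map_single, hf]

theorem map_homotopy (hf : ∀ n v, f (b n v) = b' n (f ∘ v)) (n : ℕ) (c : TupleChains K n) :
    map f (n + 1) (homotopy b n c) = homotopy b' n (map f n c) := by
  induction n with
  | zero => simp [homotopy_zero]
  | succ n ih =>
    suffices h : map f (n + 2) ∘ₗ homotopy b (n + 1) =
        homotopy b' (n + 1) ∘ₗ map f (n + 1) from LinearMap.congr_fun h c
    refine Finsupp.lhom_ext' fun v => LinearMap.ext_ring ?_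
    simp only [LinearMap.comp_apply, Finsupp.lsingle_apply, homotopy_succ_single, map_cone, ih,
      map_boundary, map_single, hf, map_sub]

end TupleChains

/-! ### Affine maps between standard simplices -/

/-- The standard simplex with `n` vertices, of dimension `n - 1`; it is empty for `n = 0`. -/
abbrev Simplex (n : ℕ) : Type := stdSimplex ℝ (Fin n)

/-- The affine map of standard simplices with prescribed images of the vertices. -/
def affineMap {m n : ℕ} (w : Fin m → Simplex n) : C(Simplex m, Simplex n) where
  toFun t := ⟨∑ j, t.1 j • (w j).1, (convex_stdSimplex ℝ (Fin n)).sum_mem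
    (fun j _ => t.2.1 j) t.2.2 fun j _ => (w j).2⟩
  continuous_toFun := by
    refine Continuous.subtype_mk (continuous_finsetSum _ fun j _ => ?_) _
    exact ((continuous_apply j).comp continuous_subtype_val).smul continuous_const

theorem affineMap_val {m n : ℕ} (w : Fin m → Simplex n) (t : Simplex m) :
    (affineMap w t).1 = ∑ j, t.1 j • (w j).1 := rfl

/-- The vertices of the standard simplex. -/
def vertices (n : ℕ) : Fin n → Simplex n := fun i => stdSimplex.vertex i

theorem affineMap_vertices_apply {m n : ℕ} (w : Fin m → Simplex n) (i : Fin m) :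
    affineMap w (vertices m i) = w i := by
  apply Subtype.ext
  simp [affineMap_val, vertices, stdSimplex.vertex, Pi.single_apply]

theorem affineMap_comp_vertices {m n : ℕ} (w : Fin m → Simplex n) :
    affineMap w ∘ vertices m = w :=
  funext (affineMap_vertices_apply w)

@[simp]
theorem affineMap_vertices (n : ℕ) : affineMap (vertices n) = ContinuousMap.id _ := by
  ext t i
  change (affineMap (vertices n) t).1 i = t.1 i
  simp [affineMap_val, vertices, stdSimplex.vertex, Finset.sum_apply, Pi.single_apply]

theorem affineMap_comp_affineMap {l m n : ℕ} (w : Fin m → Simplex n) (v : Fin l → Simplex m) :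
    (affineMap w).comp (affineMap v) = affineMap (affineMap w ∘ v) := by
  ext t i
  change (affineMap w (affineMap v t)).1 i = (affineMap (affineMap w ∘ v) t).1 i
  simp only [affineMap_val, Function.comp_apply, Finset.sum_apply, Pi.smul_apply, smul_eq_mul,
    Finset.sum_mul, Finset.mul_sum]
  rw [Finset.sum_comm]
  simp only [mul_assoc]

/-- The barycentre of a nonempty tuple of points of a standard simplex. -/
def barycenter (n : ℕ) {N : ℕ} (v : Fin (n + 1) → Simplex N) : Simplex N :=
  affineMap v stdSimplex.barycenter

theorem affineMap_barycenter {n m N : ℕ} (w : Fin m → Simplex N) (v : Fin (n + 1) → Simplex m) :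
    affineMap w (barycenter n v) = barycenter n (affineMap w ∘ v) :=
  DFunLike.congr_fun (affineMap_comp_affineMap w v) _

/-! ### Singular chains and their subdivision -/

section Singular

variable {Y : Type u} [TopologicalSpace Y]

/-- Augmented singular chains, indexed by the number of vertices of the simplices: the free abelian
group on the continuous maps `Simplex n → Y`. Since `Simplex 0` is empty, the term of index `0` is
free of rank one, and it is the target of the augmentation. -/
abbrev SingularChains (Y : Type u) [TopologicalSpace Y] (n : ℕ) := C(Simplex n, Y) →₀ ℤ

namespace SingularChains

/-- The `i`-th face of a singular simplex. -/
def face {n : ℕ} (i : Fin (n + 1)) (σ : C(Simplex (n + 1), Y)) : C(Simplex n, Y) :=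
  σ.comp (affineMap (vertices (n + 1) ∘ i.succAbove))

/-- The boundary of augmented singular chains. -/
def boundary (n : ℕ) : SingularChains Y (n + 1) →ₗ[ℤ] SingularChains Y n :=
  Finsupp.linearCombination ℤ fun σ =>
    ∑ i : Fin (n + 1), (-1 : ℤ) ^ (i : ℕ) • Finsupp.single (face i σ) 1

theorem boundary_single {n : ℕ} (σ : C(Simplex (n + 1), Y)) :
    boundary n (Finsupp.single σ 1) =
      ∑ i : Fin (n + 1), (-1 : ℤ) ^ (i : ℕ) • Finsupp.single (face i σ) 1 := by
  simp [boundary]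

/-- The singular chain obtained from a chain of tuples of points of a standard simplex by taking
affine simplices and composing them with a given singular simplex. -/
def ofTuples {m : ℕ} (σ : C(Simplex m, Y)) (n : ℕ) :
    TupleChains (Simplex m) n →ₗ[ℤ] SingularChains Y n :=
  Finsupp.lmapDomain ℤ ℤ fun w => σ.comp (affineMap w)

@[simp]
theorem ofTuples_single {m : ℕ} (σ : C(Simplex m, Y)) {n : ℕ} (w : Fin n → Simplex m) :
    ofTuples σ n (Finsupp.single w 1) = Finsupp.single (σ.comp (affineMap w)) 1 := by
  simp [ofTuples]

theorem ofTuples_vertices {n : ℕ} (σ : C(Simplex n, Y)) :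
    ofTuples σ n (Finsupp.single (vertices n) 1) = Finsupp.single σ 1 := by
  simp

theorem boundary_ofTuples {m : ℕ} (σ : C(Simplex m, Y)) (n : ℕ)
    (c : TupleChains (Simplex m) (n + 1)) :
    boundary n (ofTuples σ (n + 1) c) = ofTuples σ n (TupleChains.boundary n c) := by
  suffices h : boundary n ∘ₗ ofTuples σ (n + 1) = ofTuples σ n ∘ₗ TupleChains.boundary n from
    LinearMap.congr_fun h c
  refine Finsupp.lhom_ext' fun w => LinearMap.ext_ring ?_
  simp only [LinearMap.comp_apply, Finsupp.lsingle_apply, ofTuples_single, boundary_single,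
    TupleChains.boundary_single, map_sum, map_smul, face, ContinuousMap.comp_assoc,
    affineMap_comp_affineMap, ← Function.comp_assoc, affineMap_comp_vertices]

theorem ofTuples_comp_affineMap {l m : ℕ} (σ : C(Simplex m, Y)) (w : Fin l → Simplex m) (n : ℕ)
    (c : TupleChains (Simplex l) n) :
    ofTuples (σ.comp (affineMap w)) n c = ofTuples σ n (TupleChains.map (affineMap w) n c) := by
  suffices h : ofTuples (σ.comp (affineMap w)) n =
      ofTuples σ n ∘ₗ TupleChains.map (affineMap w) n from LinearMap.congr_fun h c
  refine Finsupp.lhom_ext' fun v => LinearMap.ext_ring ?_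
  simp [ContinuousMap.comp_assoc, affineMap_comp_affineMap]

theorem boundary_boundary (n : ℕ) (c : SingularChains Y (n + 2)) :
    boundary n (boundary (n + 1) c) = 0 := by
  suffices h : boundary n ∘ₗ boundary (n + 1) = (0 : SingularChains Y (n + 2) →ₗ[ℤ] _) from
    LinearMap.congr_fun h c
  refine Finsupp.lhom_ext' fun σ => LinearMap.ext_ring ?_
  rw [LinearMap.comp_apply, Finsupp.lsingle_apply, ← ofTuples_vertices, LinearMap.comp_apply,
    boundary_ofTuples, boundary_ofTuples, TupleChains.boundary_boundary, map_zero]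
  rfl

/-- Barycentric subdivision of singular chains. -/
def subdivision (n : ℕ) : SingularChains Y n →ₗ[ℤ] SingularChains Y n :=
  Finsupp.linearCombination ℤ fun σ =>
    ofTuples σ n (TupleChains.subdivision (fun k => barycenter k) n
      (Finsupp.single (vertices n) 1))

/-- The natural chain homotopy from the identity to barycentric subdivision. -/
def homotopy (n : ℕ) : SingularChains Y n →ₗ[ℤ] SingularChains Y (n + 1) :=
  Finsupp.linearCombination ℤ fun σ =>
    ofTuples σ (n + 1) (TupleChains.homotopy (fun k => barycenter k) n
      (Finsupp.single (vertices n) 1))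

theorem subdivision_ofTuples {m : ℕ} (σ : C(Simplex m, Y)) (n : ℕ)
    (c : TupleChains (Simplex m) n) :
    subdivision n (ofTuples σ n c) =
      ofTuples σ n (TupleChains.subdivision (fun k => barycenter k) n c) := by
  suffices h : subdivision n ∘ₗ ofTuples σ n =
      ofTuples σ n ∘ₗ TupleChains.subdivision (fun k => barycenter k) n from
    LinearMap.congr_fun h c
  refine Finsupp.lhom_ext' fun w => LinearMap.ext_ring ?_
  simp only [LinearMap.comp_apply, Finsupp.lsingle_apply, ofTuples_single, subdivision,
    Finsupp.linearCombination_single, one_smul, ofTuples_comp_affineMap]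
  rw [TupleChains.map_subdivision (fun _ _ => affineMap_barycenter _ _), TupleChains.map_single,
    affineMap_comp_vertices]

theorem homotopy_ofTuples {m : ℕ} (σ : C(Simplex m, Y)) (n : ℕ)
    (c : TupleChains (Simplex m) n) :
    homotopy n (ofTuples σ n c) =
      ofTuples σ (n + 1) (TupleChains.homotopy (fun k => barycenter k) n c) := by
  suffices h : homotopy n ∘ₗ ofTuples σ n =
      ofTuples σ (n + 1) ∘ₗ TupleChains.homotopy (fun k => barycenter k) n from
    LinearMap.congr_fun h c
  refine Finsupp.lhom_ext' fun w => LinearMap.ext_ring ?_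
  simp only [LinearMap.comp_apply, Finsupp.lsingle_apply, ofTuples_single, homotopy,
    Finsupp.linearCombination_single, one_smul, ofTuples_comp_affineMap]
  rw [TupleChains.map_homotopy (fun _ _ => affineMap_barycenter _ _), TupleChains.map_single,
    affineMap_comp_vertices]

theorem boundary_subdivision (n : ℕ) (c : SingularChains Y (n + 1)) :
    boundary n (subdivision (n + 1) c) = subdivision n (boundary n c) := by
  suffices h : boundary n ∘ₗ subdivision (n + 1) =
      (subdivision n ∘ₗ boundary n : SingularChains Y (n + 1) →ₗ[ℤ] _) from
    LinearMap.congr_fun h c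
  refine Finsupp.lhom_ext' fun σ => LinearMap.ext_ring ?_
  simp only [LinearMap.comp_apply, Finsupp.lsingle_apply]
  rw [← ofTuples_vertices, subdivision_ofTuples, boundary_ofTuples,
    boundary_ofTuples, subdivision_ofTuples, TupleChains.boundary_subdivision]

theorem boundary_homotopy_zero (c : SingularChains Y 0) :
    boundary 0 (homotopy 0 c) = c - subdivision 0 c := by
  suffices h : boundary 0 ∘ₗ homotopy 0 =
      (LinearMap.id - subdivision 0 : SingularChains Y 0 →ₗ[ℤ] _) from LinearMap.congr_fun h c
  refine Finsupp.lhom_ext' fun σ => LinearMap.ext_ring ?_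
  simp only [LinearMap.comp_apply, LinearMap.sub_apply, LinearMap.id_apply, Finsupp.lsingle_apply]
  rw [← ofTuples_vertices, homotopy_ofTuples,
    boundary_ofTuples, subdivision_ofTuples, TupleChains.boundary_homotopy_zero, map_sub]

theorem boundary_homotopy (n : ℕ) (c : SingularChains Y (n + 1)) :
    boundary (n + 1) (homotopy (n + 1) c) =
      c - subdivision (n + 1) c - homotopy n (boundary n c) := by
  suffices h : boundary (n + 1) ∘ₗ homotopy (n + 1) =
      (LinearMap.id - subdivision (n + 1) - homotopy n ∘ₗ boundary n :
        SingularChains Y (n + 1) →ₗ[ℤ] _) from LinearMap.congr_fun h c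
  refine Finsupp.lhom_ext' fun σ => LinearMap.ext_ring ?_
  simp only [LinearMap.comp_apply, LinearMap.sub_apply, LinearMap.id_apply, Finsupp.lsingle_apply]
  rw [← ofTuples_vertices, homotopy_ofTuples,
    boundary_ofTuples, boundary_ofTuples, subdivision_ofTuples, homotopy_ofTuples,
    TupleChains.boundary_homotopy, map_sub, map_sub]

/-- Iterated subdivision of a singular simplex is governed by that of the vertices of the standard
simplex, where diameters can be measured. -/
theorem subdivision_iterate_ofTuples {m : ℕ} (σ : C(Simplex m, Y)) (n k : ℕ)
    (c : TupleChains (Simplex m) n) :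
    (subdivision n)^[k] (ofTuples σ n c) =
      ofTuples σ n ((TupleChains.subdivision (fun k => barycenter k) n)^[k] c) := by
  induction k generalizing c with
  | zero => rfl
  | succ k ih => rw [Function.iterate_succ_apply, subdivision_ofTuples, ih,
      Function.iterate_succ_apply]

/-! ### Acyclic families of singular simplices -/

/-- The cycles of the augmented singular chain complex; every chain of index `0` is one. -/
def cycles (Y : Type u) [TopologicalSpace Y] : ∀ n, Submodule ℤ (SingularChains Y n)
  | 0 => ⊤
  | n + 1 => LinearMap.ker (boundary n)

theorem mem_cycles_succ {n : ℕ} {c : SingularChains Y (n + 1)} :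
    c ∈ cycles Y (n + 1) ↔ boundary n c = 0 := Iff.rfl

theorem boundary_mem_cycles (n : ℕ) (c : SingularChains Y (n + 1)) :
    boundary n c ∈ cycles Y n := by
  cases n with
  | zero => trivial
  | succ n => exact boundary_boundary n c

theorem subdivision_mem_cycles {n : ℕ} {c : SingularChains Y n} (hc : c ∈ cycles Y n) :
    subdivision n c ∈ cycles Y n := by
  cases n with
  | zero => trivial
  | succ n => rw [mem_cycles_succ] at hc ⊢; rw [boundary_subdivision, hc, map_zero]

theorem boundary_homotopy_of_mem_cycles {n : ℕ} {c : SingularChains Y n} (hc : c ∈ cycles Y n) :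
    boundary n (homotopy n c) = c - subdivision n c := by
  cases n with
  | zero => exact boundary_homotopy_zero c
  | succ n => rw [boundary_homotopy, mem_cycles_succ.1 hc, map_zero, sub_zero]

end SingularChains

open SingularChains

/-- The families of singular simplices of `Y` that are stable under composition with affine maps of
standard simplices. They form a distributive lattice, and those that matter are the simplices that
lie in a given subset, with their finite unions and intersections. -/
def simplexFamilies (Y : Type u) [TopologicalSpace Y] :
    Sublattice (∀ n, Set C(Simplex n, Y)) where
  carrier := {P | ∀ m n (σ : C(Simplex n, Y)) (w : Fin m → Simplex n),
    σ ∈ P n → σ.comp (affineMap w) ∈ P m}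
  supClosed' := fun _ hP _ hQ m n σ w h => h.imp (hP m n σ w) (hQ m n σ w)
  infClosed' := fun _ hP _ hQ m n σ w h => ⟨hP m n σ w h.1, hQ m n σ w h.2⟩

/-- The lattice of families of singular simplices stable under affine maps. -/
abbrev SimplexFamily (Y : Type u) [TopologicalSpace Y] : Type u := simplexFamilies Y

namespace SimplexFamily

/-- The chains all of whose simplices belong to a given family. -/
def chains (P : SimplexFamily Y) (n : ℕ) : Submodule ℤ (SingularChains Y n) :=
  Finsupp.supported ℤ ℤ (P.1 n)

theorem single_mem_chains {P : SimplexFamily Y} {n : ℕ} {σ : C(Simplex n, Y)}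
    (h : σ ∈ P.1 n) (a : ℤ) : Finsupp.single σ a ∈ P.chains n :=
  Finsupp.single_mem_supported ℤ a h

theorem chains_mono {P Q : SimplexFamily Y} (h : P ≤ Q) (n : ℕ) : P.chains n ≤ Q.chains n :=
  Finsupp.supported_mono (h n)

theorem chains_sup (P Q : SimplexFamily Y) (n : ℕ) :
    (P ⊔ Q).chains n = P.chains n ⊔ Q.chains n :=
  Finsupp.supported_union _ _

theorem chains_inf (P Q : SimplexFamily Y) (n : ℕ) :
    (P ⊓ Q).chains n = P.chains n ⊓ Q.chains n :=
  Finsupp.supported_inter _ _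

/-- A linear map on chains takes values in a submodule if it does so on simplices. -/
theorem map_mem_of_single {P : SimplexFamily Y} {n : ℕ} {M : Type*} [AddCommGroup M]
    (f : SingularChains Y n →ₗ[ℤ] M) (N : Submodule ℤ M)
    (h : ∀ σ ∈ P.1 n, f (Finsupp.single σ 1) ∈ N) {c : SingularChains Y n} (hc : c ∈ P.chains n) :
    f c ∈ N := by
  rw [chains, Finsupp.supported_eq_span_single] at hc
  have : Submodule.span ℤ ((fun σ => Finsupp.single σ (1 : ℤ)) '' P.1 n) ≤ N.comap f :=
    Submodule.span_le.2 (by rintro _ ⟨σ, hσ, rfl⟩; exact h σ hσ)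
  exact this hc

theorem ofTuples_mem_chains {P : SimplexFamily Y} {m : ℕ} {σ : C(Simplex m, Y)} (h : σ ∈ P.1 m)
    (n : ℕ) (c : TupleChains (Simplex m) n) : ofTuples σ n c ∈ P.chains n := by
  induction c using Finsupp.induction_linear with
  | zero => simp
  | add c d hc hd => rw [map_add]; exact add_mem hc hd
  | single w a =>
    simp only [ofTuples, Finsupp.lmapDomain_apply, Finsupp.mapDomain_single]
    exact single_mem_chains (P.2 _ _ σ w h) a

theorem boundary_mem_chains {P : SimplexFamily Y} {n : ℕ} {c : SingularChains Y (n + 1)}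
    (hc : c ∈ P.chains (n + 1)) : boundary n c ∈ P.chains n := by
  refine map_mem_of_single _ _ (fun σ hσ => ?_) hc
  rw [← ofTuples_vertices, boundary_ofTuples]
  exact ofTuples_mem_chains hσ _ _

theorem subdivision_mem_chains {P : SimplexFamily Y} {n : ℕ} {c : SingularChains Y n}
    (hc : c ∈ P.chains n) : subdivision n c ∈ P.chains n := by
  refine map_mem_of_single _ _ (fun σ hσ => ?_) hc
  rw [← ofTuples_vertices, subdivision_ofTuples]
  exact ofTuples_mem_chains hσ _ _

theorem homotopy_mem_chains {P : SimplexFamily Y} {n : ℕ} {c : SingularChains Y n}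
    (hc : c ∈ P.chains n) : homotopy n c ∈ P.chains (n + 1) := by
  refine map_mem_of_single _ _ (fun σ hσ => ?_) hc
  rw [← ofTuples_vertices, homotopy_ofTuples]
  exact ofTuples_mem_chains hσ _ _

/-- A family of simplices is acyclic if its augmented chain complex is exact. -/
def Acyclic (P : SimplexFamily Y) : Prop :=
  ∀ n, ∀ c ∈ P.chains n, c ∈ cycles Y n → ∃ b ∈ P.chains (n + 1), boundary n b = c

/-- The part of the Mayer–Vietoris sequence that passes from an intersection to a union. -/
theorem Acyclic.sup {P Q : SimplexFamily Y} (hP : P.Acyclic) (hQ : Q.Acyclic)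
    (hPQ : (P ⊓ Q).Acyclic) : (P ⊔ Q).Acyclic := by
  intro n c hc hcyc
  rw [chains_sup] at hc ⊢
  obtain ⟨p, hp, q, hq, rfl⟩ := Submodule.mem_sup.1 hc
  -- `p` and `q` can be changed by an element of the intersection so as to become cycles
  obtain ⟨r, hr, hpr, hqr⟩ :
      ∃ r ∈ (P ⊓ Q).chains n, p - r ∈ cycles Y n ∧ q + r ∈ cycles Y n := by
    cases n with
    | zero => exact ⟨0, zero_mem _, trivial, trivial⟩
    | succ n =>
      rw [mem_cycles_succ, map_add] at hcyc
      have h : boundary n p = - boundary n q := eq_neg_of_add_eq_zero_left hcyc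
      obtain ⟨r, hr, hbr⟩ := hPQ n (boundary n p)
        (by
          rw [chains_inf]
          exact ⟨boundary_mem_chains hp, by rw [h]; exact neg_mem (boundary_mem_chains hq)⟩)
        (boundary_mem_cycles n p)
      refine ⟨r, hr, ?_, ?_⟩
      · rw [mem_cycles_succ, map_sub, hbr, sub_self]
      · rw [mem_cycles_succ, map_add, hbr, add_comm, hcyc]
  rw [chains_inf] at hr
  obtain ⟨x, hx, hbx⟩ := hP n _ (sub_mem hp hr.1) hpr
  obtain ⟨y, hy, hby⟩ := hQ n _ (add_mem hq hr.2) hqr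
  refine ⟨x + y, Submodule.add_mem_sup hx hy, ?_⟩
  rw [map_add, hbx, hby]
  abel

/-- The part of the Mayer–Vietoris sequence that passes from a union to an intersection. -/
theorem Acyclic.inf {P Q : SimplexFamily Y} (hP : P.Acyclic) (hQ : Q.Acyclic)
    (hPQ : (P ⊔ Q).Acyclic) : (P ⊓ Q).Acyclic := by
  intro n c hc hcyc
  rw [chains_inf] at hc ⊢
  obtain ⟨p, hp, hbp⟩ := hP n c hc.1 hcyc
  obtain ⟨q, hq, hbq⟩ := hQ n c hc.2 hcyc
  obtain ⟨r, hr, hbr⟩ := hPQ (n + 1) (p - q)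
    (by rw [chains_sup]; exact sub_mem (Submodule.mem_sup_left hp) (Submodule.mem_sup_right hq))
    (by rw [mem_cycles_succ, map_sub, hbp, hbq, sub_self])
  rw [chains_sup] at hr
  obtain ⟨x, hx, y, hy, rfl⟩ := Submodule.mem_sup.1 hr
  have h : p - boundary (n + 1) x = q + boundary (n + 1) y := by
    rw [map_add] at hbr
    rw [sub_eq_iff_eq_add, add_assoc, add_comm (boundary _ y), hbr]
    abel
  refine ⟨p - boundary (n + 1) x, ⟨sub_mem hp (boundary_mem_chains hx), ?_⟩, ?_⟩
  · rw [h]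
    exact add_mem hq (boundary_mem_chains hy)
  · rw [map_sub, hbp, boundary_boundary, sub_zero]

/-- If every chain of `Q` has an iterated subdivision in the smaller family `P`, then subdivision
shows that the inclusion of `P` into `Q` does not change homology; only the consequence for
acyclicity is stated. -/
theorem acyclic_iff_of_subdivision {P Q : SimplexFamily Y} (hPQ : P ≤ Q)
    (h : ∀ n, ∀ c ∈ Q.chains n, ∃ k, (subdivision n)^[k] c ∈ P.chains n) :
    P.Acyclic ↔ Q.Acyclic := by
  have key (R : SimplexFamily Y) (n k : ℕ) (c : SingularChains Y n) (hc : c ∈ R.chains n)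
      (hcyc : c ∈ cycles Y n) : (subdivision n)^[k] c ∈ cycles Y n ∧
        ∃ b ∈ R.chains (n + 1), boundary n b = c - (subdivision n)^[k] c := by
    induction k generalizing c with
    | zero => exact ⟨hcyc, 0, zero_mem _, by simp⟩
    | succ k ih =>
      obtain ⟨h1, b, hb, hbb⟩ := ih _ (subdivision_mem_chains hc) (subdivision_mem_cycles hcyc)
      rw [Function.iterate_succ_apply]
      refine ⟨h1, homotopy n c + b, add_mem (homotopy_mem_chains hc) hb, ?_⟩
      rw [map_add, hbb, boundary_homotopy_of_mem_cycles hcyc]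
      abel
  constructor
  · intro hP n c hc hcyc
    obtain ⟨k, hk⟩ := h n c hc
    obtain ⟨hkc, b, hb, hbb⟩ := key Q n k c hc hcyc
    obtain ⟨a, ha, hba⟩ := hP n _ hk hkc
    exact ⟨b + a, add_mem hb (chains_mono hPQ _ ha), by rw [map_add, hbb, hba, sub_add_cancel]⟩
  · intro hQ n c hc hcyc
    obtain ⟨a, ha, rfl⟩ := hQ n c (chains_mono hPQ _ hc) hcyc
    obtain ⟨k, hk⟩ := h (n + 1) a ha
    obtain ⟨-, b, hb, hbb⟩ := key P n k _ hc hcyc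
    have hcomm : boundary n ((subdivision (n + 1))^[k] a) =
        (subdivision n)^[k] (boundary n a) :=
      Function.Semiconj.iterate_right (f := boundary n) (boundary_subdivision n) k a
    exact ⟨b + _, add_mem hb hk, by rw [map_add, hbb, hcomm, sub_add_cancel]⟩

end SimplexFamily

end Singular

/-! ### Small simplices -/

/-- The barycentre of `m + 1` points with mutual distances at most `D` has distance at most
`m / (m + 1) * D` from each of them, since one of the `m + 1` differences in the average is zero;
hence also from the points of their convex hull. The bound is increasing in `m`. -/
theorem dist_barycenter_le {m M N : ℕ} (hm : m ≤ M) {D : ℝ} (hD : 0 ≤ D)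
    (v : Fin (m + 1) → Simplex N) (hv : ∀ i j, dist (v i) (v j) ≤ D) (x : Simplex N)
    (hx : x.1 ∈ convexHull ℝ (Set.range fun i => (v i).1)) :
    dist (barycenter m v) x ≤ M / (M + 1) * D := by
  -- a ball is convex, so it suffices to bound the distances to the vertices
  suffices h : Set.range (fun i => (v i).1) ⊆
      Metric.closedBall (barycenter m v).1 (M / (M + 1) * D) by
    rw [dist_comm]
    exact convexHull_min h (convex_closedBall _ _) hx
  rintro _ ⟨i, rfl⟩
  have hm' : (0 : ℝ) < m + 1 := by positivity
  have hb : (v i).1 - (barycenter m v).1 = ∑ j, (m + 1 : ℝ)⁻¹ • ((v i).1 - (v j).1) := by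
    rw [barycenter, affineMap_val]
    simp only [stdSimplex.barycenter_apply, Fintype.card_fin, smul_sub, Finset.sum_sub_distrib,
      Finset.sum_const, Finset.card_univ, Nat.cast_add, Nat.cast_one]
    congr 1
    rw [← Nat.cast_smul_eq_nsmul ℝ, smul_smul, Nat.cast_add, Nat.cast_one,
      mul_inv_cancel₀ hm'.ne', one_smul]
  rw [Metric.mem_closedBall, dist_eq_norm, hb]
  have hle (j : Fin (m + 1)) : ‖(m + 1 : ℝ)⁻¹ • ((v i).1 - (v j).1)‖ ≤
      if j = i then 0 else (m + 1 : ℝ)⁻¹ * D := by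
    split_ifs with h
    · simp [h]
    · rw [norm_smul, Real.norm_of_nonneg (by positivity)]
      gcongr
      rw [← dist_eq_norm]
      exact hv i j
  calc _ ≤ ∑ j, if j = i then 0 else (m + 1 : ℝ)⁻¹ * D := norm_sum_le_of_le _ fun j _ => hle j
    _ = m / (m + 1) * D := by
      rw [Finset.sum_ite, Finset.sum_const_zero, zero_add, Finset.sum_const, nsmul_eq_mul]
      rw [Finset.filter_not, Finset.filter_eq' Finset.univ i, if_pos (Finset.mem_univ i),
        Finset.card_sdiff]
      simp
      ring
    _ ≤ M / (M + 1) * D := by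
      gcongr ?_ * D
      rw [div_le_div_iff₀ hm' (by positivity)]
      have : (m : ℝ) ≤ M := by exact_mod_cast hm
      nlinarith

namespace TupleChains

/-- Barycentric subdivision shrinks the diameter of the simplices with at most `M + 1` vertices by
the factor `M / (M + 1)`. The statement about convex hulls is what makes the induction work. -/
theorem subdivision_single_mem_supported {M N : ℕ} {D : ℝ} (hD : 0 ≤ D) :
    ∀ {m : ℕ} (_ : m ≤ M + 1) (v : Fin m → Simplex N) (_ : ∀ i j, dist (v i) (v j) ≤ D),
      subdivision (fun k => barycenter k) m (Finsupp.single v 1) ∈ Finsupp.supported ℤ ℤ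
        {w | (∀ i j, dist (w i) (w j) ≤ M / (M + 1) * D) ∧
          ∀ j, (w j).1 ∈ convexHull ℝ (Set.range fun i => (v i).1)}
  | 0, _, _, _ => Finsupp.single_mem_supported _ _ ⟨fun i => i.elim0, fun i => i.elim0⟩
  | m + 1, hm, v, hv => by
    rw [subdivision_succ_single, boundary_single, map_sum, map_sum]
    refine sum_mem fun i _ => ?_
    rw [map_smul, map_smul]
    refine Submodule.smul_mem _ _ ?_
    have ih := subdivision_single_mem_supported (M := M) hD (by omega : m ≤ M + 1) (v ∘ i.succAbove)
      fun j k => hv _ _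
    refine Finsupp.supported_mono ?_ ((Finsupp.lmapDomain_supported ℤ ℤ _ _).le
      (Submodule.mem_map_of_mem ih))
    rintro _ ⟨w, ⟨hw1, hw2⟩, rfl⟩
    have hsub : ∀ j, (w j).1 ∈ convexHull ℝ (Set.range fun i => (v i).1) := fun j =>
      convexHull_mono (by rintro _ ⟨k, rfl⟩; exact ⟨_, rfl⟩) (hw2 j)
    have hb (j) := dist_barycenter_le (Nat.le_of_succ_le_succ hm) hD v hv (w j) (hsub j)
    constructor
    · intro j k
      refine Fin.cases ?_ (fun j => ?_) j <;> refine Fin.cases ?_ (fun k => ?_) k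
      · simp; positivity
      · simpa using hb k
      · simpa [dist_comm] using hb j
      · simpa using hw1 j k
    · refine Fin.cases ?_ hsub
      exact (convex_convexHull ℝ _).sum_mem (fun j _ => (stdSimplex.barycenter).2.1 j)
        (stdSimplex.barycenter).2.2 fun j _ => subset_convexHull ℝ _ (Set.mem_range_self j)

theorem subdivision_iterate_mem_supported {M N m : ℕ} (hm : m ≤ M + 1) (v : Fin m → Simplex N)
    {D : ℝ} (hD : 0 ≤ D) (hv : ∀ i j, dist (v i) (v j) ≤ D) (k : ℕ) :
    (subdivision (fun k => barycenter k) m)^[k] (Finsupp.single v 1) ∈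
      Finsupp.supported ℤ ℤ {w | ∀ i j, dist (w i) (w j) ≤ (M / (M + 1) : ℝ) ^ k * D} := by
  induction k with
  | zero => exact Finsupp.single_mem_supported _ _ (by simpa using hv)
  | succ k ih =>
    rw [Function.iterate_succ_apply']
    rw [Finsupp.supported_eq_span_single] at ih
    refine (Submodule.span_le (p := (Finsupp.supported ℤ ℤ _).comap
      (subdivision (fun k => barycenter k) m))).2 ?_ ih
    rintro _ ⟨w, hw, rfl⟩
    refine Finsupp.supported_mono ?_
      (subdivision_single_mem_supported (by positivity) hm w hw)
    rintro x ⟨hx, -⟩ i j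
    exact (hx i j).trans_eq (by ring)

end TupleChains

/-- The singular simplices that lie in a given subset. -/
def simplicesIn {X : Type u} [TopologicalSpace X] (A : Set X) : SimplexFamily X :=
  ⟨fun _ => {σ | ∀ t, σ t ∈ A}, fun _ _ _ _ h _ => h _⟩

section Small

open SingularChains SimplexFamily

variable {X : Type u} [TopologicalSpace X] {S : Type v} {U : S → Set X} {θ : Finset S}

theorem simplicesIn_mono {A B : Set X} (h : A ⊆ B) : simplicesIn A ≤ simplicesIn B :=
  fun _ _ hσ t => h (hσ t)

theorem simplicesIn_iInter (hθ : θ.Nonempty) :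
    simplicesIn (⋂ a ∈ θ, U a) = θ.inf' hθ fun a => simplicesIn (U a) := by
  refine le_antisymm (Finset.le_inf' _ _ fun a ha =>
    simplicesIn_mono (Set.biInter_subset_of_mem ha)) fun n σ hσ t => ?_
  exact Set.mem_iInter₂.2 fun a ha =>
    (Finset.inf'_le (fun a => simplicesIn (U a)) ha : _ ≤ simplicesIn (U a)) n hσ t

theorem relInterior_eq (V A : Set X) : ∃ O, IsOpen O ∧ relInterior V A = V ∩ O := by
  obtain ⟨O, hO, h⟩ := isOpen_induced_iff.1 (isOpen_interior (s := (Subtype.val ⁻¹' A : Set V)))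
  exact ⟨O, hO, by rw [relInterior, ← h, Subtype.image_preimage_coe]⟩

theorem relInterior_subset (V A : Set X) : relInterior V A ⊆ A := by
  rintro _ ⟨x, hx, rfl⟩
  exact (interior_subset (s := (Subtype.val ⁻¹' A : Set V)) hx : _)

/-- By Lebesgue's lemma, iterated subdivision makes a simplex of the union small: each piece lies in
one member of the family. -/
theorem exists_subdivision_single_mem (hθ : θ.Nonempty)
    (hU : CoveredByInteriors fun a : θ => U a) {n : ℕ} {σ : C(Simplex n, X)}
    (hσ : ∀ t, σ t ∈ ⋃ a ∈ θ, U a) :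
    ∃ k, (subdivision n)^[k] (Finsupp.single σ 1) ∈
      (θ.sup' hθ fun a => simplicesIn (U a)).chains n := by
  have hle {a : S} (ha : a ∈ θ) :
      simplicesIn (U a) ≤ θ.sup' hθ fun a => simplicesIn (U a) :=
    Finset.le_sup' (fun a => simplicesIn (U a)) ha
  cases n with
  | zero =>
    obtain ⟨a, ha⟩ := hθ
    have : IsEmpty (Simplex 0) := by
      rw [Set.isEmpty_coe_sort, stdSimplex_of_isEmpty_index]
    exact ⟨0, single_mem_chains (hle ha 0 fun t => isEmptyElim t) 1⟩
  | succ M =>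
    choose O hO hVO using fun a : θ => relInterior_eq (⋃ b : θ, U b) (U a)
    have hV (t) : σ t ∈ ⋃ b : θ, U b := by
      simpa [Set.mem_iUnion] using hσ t
    have hcover : Set.univ ⊆ ⋃ a, σ ⁻¹' O a := by
      intro t _
      have h := hV t
      rw [hU] at h
      obtain ⟨a, ha⟩ := Set.mem_iUnion.1 h
      rw [hVO] at ha
      exact Set.mem_iUnion.2 ⟨a, ha.2⟩
    obtain ⟨δ, hδ, hball⟩ := lebesgue_number_lemma_of_metric isCompact_univ
      (fun a => (hO a).preimage σ.continuous) hcover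
    obtain ⟨k, hk⟩ := exists_pow_lt_of_lt_one hδ
      (show (M / (M + 1) : ℝ) < 1 by rw [div_lt_one (by positivity)]; linarith)
    refine ⟨k, ?_⟩
    have hdist (i j : Fin (M + 1)) :
        dist (vertices (M + 1) i) (vertices (M + 1) j) ≤ 1 :=
      (Metric.dist_le_diam_of_mem (bounded_stdSimplex _) (vertices _ i).2 (vertices _ j).2).trans
        diam_stdSimplex_le
    have hsmall := TupleChains.subdivision_iterate_mem_supported le_rfl _ zero_le_one hdist k
    rw [← ofTuples_vertices, subdivision_iterate_ofTuples]
    refine Finsupp.supported_mono ?_ ((Finsupp.lmapDomain_supported ℤ ℤ _ _).le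
      (Submodule.mem_map_of_mem hsmall))
    rintro _ ⟨w, hw, rfl⟩
    obtain ⟨a, ha⟩ := hball (w 0) trivial
    refine hle a.2 _ fun t => relInterior_subset (⋃ b : θ, U b) (U a) ?_
    rw [hVO]
    refine ⟨hV _, @ha (affineMap w t) ?_⟩
    -- the affine simplex with vertices `w j` stays in the ball, because balls are convex
    have hmem : (affineMap w t).1 ∈ Metric.ball (w 0).1 δ :=
      (convex_ball _ _).sum_mem (fun j _ => t.2.1 j) t.2.2 fun j _ => by
        refine (hw j 0).trans_lt ?_
        rwa [mul_one]
    exact hmem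

/-- The theorem of small simplices: the simplices of a union that lie in one of the members compute
the homology of the union. -/
theorem acyclic_sup_iff (hθ : θ.Nonempty) (hU : CoveredByInteriors fun a : θ => U a) :
    (θ.sup' hθ fun a => simplicesIn (U a)).Acyclic ↔ (simplicesIn (⋃ a ∈ θ, U a)).Acyclic := by
  refine acyclic_iff_of_subdivision
    (Finset.sup'_le _ _ fun a ha => simplicesIn_mono (Set.subset_biUnion_of_mem ha)) fun n c hc => ?_
  set P := θ.sup' hθ fun a => simplicesIn (U a)
  have hmono {k l : ℕ} (hkl : k ≤ l) {c : SingularChains X n}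
      (h : (subdivision n)^[k] c ∈ P.chains n) : (subdivision n)^[l] c ∈ P.chains n := by
    induction l, hkl using Nat.le_induction with
    | base => exact h
    | succ l _ ih => rw [Function.iterate_succ_apply']; exact subdivision_mem_chains ih
  -- the chains with a small iterated subdivision form a submodule
  let N : Submodule ℤ (SingularChains X n) :=
    { carrier := {c | ∃ k, (subdivision n)^[k] c ∈ P.chains n}
      zero_mem' := ⟨0, zero_mem _⟩
      add_mem' := by
        rintro c d ⟨k, hk⟩ ⟨l, hl⟩
        exact ⟨max k l, by
          rw [iterate_map_add]
          exact add_mem (hmono (le_max_left k l) hk) (hmono (le_max_right k l) hl)⟩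
      smul_mem' := by
        rintro a c ⟨k, hk⟩
        refine ⟨k, ?_⟩
        rw [← Module.End.pow_apply, map_smul, Module.End.pow_apply]
        exact Submodule.smul_mem _ a hk }
  exact map_mem_of_single (P := simplicesIn (⋃ a ∈ θ, U a)) LinearMap.id N
    (fun σ hσ => exists_subdivision_single_mem hθ hU hσ) hc

end Small

/-! ### Intersections and unions in a distributive lattice -/

/-- In a distributive lattice, let `p` be a property that passes from `x`, `y` and `x ⊓ y` to
`x ⊔ y`. If it holds for all meets of nonempty subfamilies of a finite family, it holds for the join
of the family. -/
theorem sup'_of_forall_inf' {α : Type*} [DistribLattice α] {p : α → Prop}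
    (hp : ∀ x y, p x → p y → p (x ⊓ y) → p (x ⊔ y)) {S : Type*} {θ : Finset S} (hθ : θ.Nonempty) :
    ∀ F : S → α, (∀ η : Finset S, ∀ hη : η.Nonempty, η ⊆ θ → p (η.inf' hη F)) →
      p (θ.sup' hθ F) := by
  classical
  induction hθ using Finset.Nonempty.cons_induction with
  | singleton a =>
    intro F h
    simpa using h {a} (Finset.singleton_nonempty a) subset_rfl
  | cons a θ ha hθ ih =>
    intro F h
    rw [Finset.sup'_cons hθ]
    refine hp _ _ ?_ (ih F fun η hη hs => h η hη (hs.trans (Finset.subset_cons ha))) ?_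
    · simpa using h {a} (Finset.singleton_nonempty a) (by simp)
    · rw [Finset.sup'_inf_distrib_left]
      -- the induction hypothesis applies to the traces of the other members on `F a`
      refine ih (fun b => F a ⊓ F b) fun η hη hs => ?_
      have := h (insert a η) (Finset.insert_nonempty a η) (by
        rw [Finset.cons_eq_insert]
        exact Finset.insert_subset_insert a hs)
      rw [Finset.inf'_insert (H := hη)] at this
      convert this using 1
      refine le_antisymm (le_inf ?_ ?_) (Finset.le_inf' _ _ fun b hb =>
        inf_le_inf_left _ (Finset.inf'_le F hb))
      · obtain ⟨b, hb⟩ := hη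
        exact (Finset.inf'_le _ hb).trans inf_le_left
      · exact Finset.le_inf' _ _ fun b hb => (Finset.inf'_le _ hb).trans inf_le_right

/-- The order dual of `sup'_of_forall_inf'`. -/
theorem inf'_of_forall_sup' {α : Type*} [DistribLattice α] {p : α → Prop}
    (hp : ∀ x y, p x → p y → p (x ⊔ y) → p (x ⊓ y)) {S : Type*} {θ : Finset S} (hθ : θ.Nonempty)
    (F : S → α) (h : ∀ η : Finset S, ∀ hη : η.Nonempty, η ⊆ θ → p (η.sup' hη F)) :
    p (θ.inf' hθ F) :=
  sup'_of_forall_inf' (α := αᵒᵈ) (p := fun x => p (OrderDual.ofDual x)) hp hθ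
    (fun a => OrderDual.toDual (F a)) h

/-! ### Comparison with the categorical definition of reduced homology -/

section Comparison

open SingularChains

/-- The inclusion of the summand of the categorical singular chains that belongs to a singular
simplex, evaluated at the generator of `ℤ`. -/
def categoricalSingle (Y : TopCat.{u}) {n : ℕ} (σ : C(Simplex (n + 1), Y)) :
    (singularChains Y).X n :=
  ((TopCat.toSSet.obj Y).ιChainComplex (n := n) (R := coeffZ)
    ((Y.toSSetObjEquiv (.op (.mk n))).symm σ)).hom (ULift.up 1)

/-- The scalar action here is the one stored in the object of `ModuleCat ℤ`; it agrees with the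
action of `ℤ` on an additive group only propositionally. -/
theorem categoricalSingle_one_smul (Y : TopCat.{u}) {n : ℕ} (σ : C(Simplex (n + 1), Y)) :
    ((singularChains Y).X n).isModule.smul (1 : ℤ) (categoricalSingle Y σ) =
      categoricalSingle Y σ :=
  @one_smul ℤ _ _ ((singularChains Y).X n).isModule.toMulAction _

/-- The terms of the categorical singular chain complex are free on the singular simplices. -/
def singularChainsEquiv (Y : TopCat.{u}) (n : ℕ) :
    (singularChains Y).X n ≃ₗ[ℤ] SingularChains Y (n + 1) :=
  let f : (singularChains Y).X n ⟶ ModuleCat.of ℤ (SingularChains Y (n + 1)) :=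
    ((TopCat.toSSet.obj Y).isColimitChainComplexXCofan (coeffZ : ModuleCat.{u} ℤ) n).desc
      (Cofan.mk (ModuleCat.of ℤ (SingularChains Y (n + 1))) fun x => ModuleCat.ofHom
        (Finsupp.lsingle (Y.toSSetObjEquiv _ x) ∘ₗ ULift.moduleEquiv.toLinearMap))
  have hf (x) : (TopCat.toSSet.obj Y).ιChainComplex (n := n) x ≫ f = ModuleCat.ofHom
      (Finsupp.lsingle (Y.toSSetObjEquiv _ x) ∘ₗ ULift.moduleEquiv.toLinearMap) :=
    ((TopCat.toSSet.obj Y).isColimitChainComplexXCofan (coeffZ : ModuleCat.{u} ℤ) n).fac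
      (Cofan.mk (ModuleCat.of ℤ (SingularChains Y (n + 1))) _) ⟨x⟩
  have hf' (σ) : f.hom (categoricalSingle Y σ) = Finsupp.single σ 1 :=
    (LinearMap.congr_fun (congrArg ModuleCat.Hom.hom (hf _)) (ULift.up 1)).trans (by simp)
  LinearEquiv.ofLinearMap f.hom (Finsupp.linearCombination ℤ (categoricalSingle Y))
    (by
      refine Finsupp.lhom_ext' fun σ => LinearMap.ext_ring ?_
      simp only [LinearMap.comp_apply, Finsupp.lsingle_apply, Finsupp.linearCombination_single,
        LinearMap.id_apply]
      exact (congrArg f.hom (categoricalSingle_one_smul Y σ)).trans (hf' σ))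
    (by
      suffices h : f ≫ ModuleCat.ofHom (Finsupp.linearCombination ℤ (categoricalSingle Y)) = 𝟙 _
        from congrArg ModuleCat.Hom.hom h
      refine SSet.chainComplex_hom_ext fun x => ?_
      rw [← Category.assoc, hf, Category.comp_id]
      refine ModuleCat.hom_ext (LinearMap.ext fun a => ?_)
      change Finsupp.linearCombination ℤ (categoricalSingle Y)
        (Finsupp.single (Y.toSSetObjEquiv _ x) a.down) = _
      rw [Finsupp.linearCombination_single, categoricalSingle, Equiv.symm_apply_apply]
      exact (((TopCat.toSSet.obj Y).ιChainComplex (n := n) (R := coeffZ) x).hom.map_smul' a.down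
        (ULift.up 1)).symm.trans (congrArg _ (ULift.ext _ _ (by simp))))

theorem singularChainsEquiv_single (Y : TopCat.{u}) {n : ℕ} (σ : C(Simplex (n + 1), Y)) :
    singularChainsEquiv Y n (categoricalSingle Y σ) = Finsupp.single σ 1 := by
  rw [← LinearEquiv.eq_symm_apply]
  exact ((Finsupp.linearCombination_single ℤ 1 σ).trans (categoricalSingle_one_smul Y σ)).symm

instance : IsEmpty (Simplex 0) := by
  rw [Set.isEmpty_coe_sort, stdSimplex_of_isEmpty_index]

instance {Y : Type u} [TopologicalSpace Y] : Unique C(Simplex 0, Y) where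
  default := ⟨isEmptyElim, continuous_of_const fun x => isEmptyElim x⟩
  uniq _ := ContinuousMap.ext isEmptyElim

/-- The term of degree `-1` of both augmented chain complexes is `ℤ`. -/
def coeffEquiv (Y : Type u) [TopologicalSpace Y] :
    (coeffZ : ModuleCat.{u} ℤ) ≃ₗ[ℤ] SingularChains Y 0 :=
  ULift.moduleEquiv.trans (Finsupp.uniqueLinearEquiv ℤ ℤ default).symm

/-- The terms of the categorical augmented chain complex are the explicit chain modules. -/
def reducedChainsEquiv (Y : TopCat.{u}) :
    ∀ n, (reducedSingularChains Y).X n ≃ₗ[ℤ] SingularChains Y n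
  | 0 => coeffEquiv Y
  | n + 1 => singularChainsEquiv Y n

theorem affineMap_comp_succAbove {n : ℕ} (i : Fin (n + 1)) (t : Simplex n) :
    affineMap (vertices (n + 1) ∘ i.succAbove) t = stdSimplex.map i.succAbove t := by
  apply Subtype.ext
  funext j
  simp [affineMap_val, vertices, stdSimplex.map, stdSimplex.vertex, Finset.sum_apply,
    FunOnFinite.linearMap_apply_apply, Pi.single_apply, Finset.sum_ite, eq_comm]
  rfl

theorem toSSetObjEquiv_δ (Y : TopCat.{u}) {n : ℕ} (i : Fin (n + 2))
    (σ : C(Simplex (n + 2), Y)) :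
    (TopCat.toSSet.obj Y).δ i ((Y.toSSetObjEquiv (.op (.mk (n + 1)))).symm σ) =
      (Y.toSSetObjEquiv (.op (.mk n))).symm (face i σ) := by
  rw [Equiv.eq_symm_apply]
  ext t
  refine (TopCat.toSSetObjEquiv_δ_apply _ _ _).trans ?_
  rw [Equiv.apply_symm_apply]
  exact congrArg σ (affineMap_comp_succAbove i t).symm

theorem d_categoricalSingle (Y : TopCat.{u}) {n : ℕ} (σ : C(Simplex (n + 2), Y)) :
    ((singularChains Y).d (n + 1) n).hom (categoricalSingle Y σ) =
      ∑ i : Fin (n + 2), (-1 : ℤ) ^ (i : ℕ) • categoricalSingle Y (face i σ) := by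
  have h := LinearMap.congr_fun (congrArg ModuleCat.Hom.hom
    ((TopCat.toSSet.obj Y).ιChainComplex_d (R := coeffZ)
      ((Y.toSSetObjEquiv (.op (.mk (n + 1)))).symm σ))) (ULift.up 1)
  refine h.trans ?_
  simp [categoricalSingle, toSSetObjEquiv_δ, ModuleCat.hom_sum]

theorem augmentation_categoricalSingle (Y : TopCat.{u}) (σ : C(Simplex 1, Y)) :
    (augmentation Y).hom (categoricalSingle Y σ) = ULift.up 1 :=
  LinearMap.congr_fun (congrArg ModuleCat.Hom.hom (ι_augmentation Y _)) (ULift.up 1)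

theorem singularChains_addHom_ext {Y : TopCat.{u}} {n : ℕ} {M : Type*} [AddCommGroup M]
    {f g : (singularChains Y).X n →+ M}
    (h : ∀ σ, f (categoricalSingle Y σ) = g (categoricalSingle Y σ)) : f = g := by
  let e := (singularChainsEquiv Y n).symm.toAddEquiv.toAddMonoidHom
  have he : f.comp e = g.comp e := by
    refine Finsupp.addHom_ext' fun σ => AddMonoidHom.ext_int ?_
    have : e (Finsupp.single σ 1) = categoricalSingle Y σ := by
      change (singularChainsEquiv Y n).symm _ = _
      rw [LinearEquiv.symm_apply_eq, singularChainsEquiv_single]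
    simpa [this] using h σ
  ext c
  obtain ⟨c, rfl⟩ := (singularChainsEquiv Y n).symm.surjective c
  exact DFunLike.congr_fun he c

theorem reducedChainsEquiv_d (Y : TopCat.{u}) (n : ℕ) (c : (reducedSingularChains Y).X (n + 1)) :
    reducedChainsEquiv Y n (((reducedSingularChains Y).d (n + 1) n).hom c) =
      boundary n (reducedChainsEquiv Y (n + 1) c) := by
  cases n with
  | zero =>
    suffices h : (coeffEquiv Y).toAddEquiv.toAddMonoidHom.comp (augmentation Y).hom.toAddMonoidHom =
        (boundary 0).toAddMonoidHom.comp (singularChainsEquiv Y 0).toAddEquiv.toAddMonoidHom from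
      DFunLike.congr_fun h c
    refine singularChains_addHom_ext fun σ => ?_
    change coeffEquiv Y ((augmentation Y).hom (categoricalSingle Y σ)) =
      boundary 0 (singularChainsEquiv Y 0 (categoricalSingle Y σ))
    rw [augmentation_categoricalSingle, singularChainsEquiv_single, boundary_single]
    simp [coeffEquiv, Subsingleton.elim (face 0 σ) default]
  | succ n =>
    suffices h : (singularChainsEquiv Y n).toAddEquiv.toAddMonoidHom.comp
          ((singularChains Y).d (n + 1) n).hom.toAddMonoidHom =
        (boundary (n + 1)).toAddMonoidHom.comp
          (singularChainsEquiv Y (n + 1)).toAddEquiv.toAddMonoidHom from DFunLike.congr_fun h c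
    refine singularChains_addHom_ext fun σ => ?_
    change singularChainsEquiv Y n (((singularChains Y).d (n + 1) n).hom _) =
      boundary (n + 1) (singularChainsEquiv Y (n + 1) _)
    rw [d_categoricalSingle]
    simp only [map_sum, map_zsmul, singularChainsEquiv_single, boundary_single]

/-- Acyclicity of a subspace in terms of the explicit chains of the subspace. In index `0` the
outgoing differential of the complex is zero, in accordance with the definition of `cycles`. -/
theorem isAcyclic_iff_forall_cycles {X : Type u} [TopologicalSpace X] (A : Set X) :
    IsAcyclic A ↔ ∀ n, ∀ c ∈ cycles A n, ∃ b, boundary n b = c := by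
  refine forall_congr' fun n => ?_
  set K := reducedSingularChains (TopCat.of A)
  let e := reducedChainsEquiv (TopCat.of A)
  rw [reducedHomology, ← HomologicalComplex.exactAt_iff_isZero_homology]
  have key (P : K.X n → Prop) (hP : ∀ c, P c ↔ e n c ∈ cycles A n) :
      (∀ c, P c → ∃ b, (K.d (n + 1) n).hom b = c) ↔
        ∀ c ∈ cycles A n, ∃ b, boundary n b = c := by
    constructor
    · intro h c hc
      obtain ⟨b, hb⟩ := h ((e n).symm c) ((hP _).2 (by rwa [LinearEquiv.apply_symm_apply]))
      exact ⟨e (n + 1) b, (reducedChainsEquiv_d _ n b).symm.trans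
        ((congrArg (e n) hb).trans ((e n).apply_symm_apply c))⟩
    · intro h c hc
      obtain ⟨b, hb⟩ := h _ ((hP c).1 hc)
      refine ⟨(e (n + 1)).symm b, (e n).injective ?_⟩
      refine (reducedChainsEquiv_d _ n _).trans ?_
      exact (congrArg _ ((e (n + 1)).apply_symm_apply b)).trans hb
  cases n with
  | zero =>
    rw [K.exactAt_iff' 1 0 0 (by simp) (by simp), ShortComplex.moduleCat_exact_iff]
    refine key _ fun c => iff_of_true ?_ trivial
    exact LinearMap.congr_fun (congrArg ModuleCat.Hom.hom (K.shape 0 0 (by simp))) c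
  | succ n =>
    rw [K.exactAt_iff' (n + 2) (n + 1) n (by simp) (by simp), ShortComplex.moduleCat_exact_iff]
    refine key _ fun c => ?_
    rw [mem_cycles_succ, ← (reducedChainsEquiv_d (TopCat.of A) n c : _ = boundary n (e (n + 1) c))]
    exact (map_eq_zero_iff (e n) (e n).injective).symm

/-- Acyclicity of a subspace in terms of chains of the ambient space. -/
theorem isAcyclic_iff {X : Type u} [TopologicalSpace X] (A : Set X) :
    IsAcyclic A ↔ (simplicesIn A).Acyclic := by
  rw [isAcyclic_iff_forall_cycles]
  refine forall_congr' fun n => ?_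
  let ι : C(A, X) := ⟨Subtype.val, continuous_subtype_val⟩
  let f (n : ℕ) : SingularChains A n →ₗ[ℤ] SingularChains X n :=
    Finsupp.lmapDomain ℤ ℤ fun σ => ι.comp σ
  have hinj (n) : Function.Injective (f n) :=
    Finsupp.mapDomain_injective fun σ τ h => ContinuousMap.ext fun t =>
      Subtype.val_injective (DFunLike.congr_fun h t)
  have hchains (n) : (simplicesIn A).chains n = LinearMap.range (f n) := by
    rw [LinearMap.range_eq_map, ← Finsupp.supported_univ, Finsupp.lmapDomain_supported,
      Set.image_univ]
    refine congrArg (Finsupp.supported ℤ ℤ) (Set.Subset.antisymm (fun σ hσ => ?_) ?_)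
    · exact ⟨⟨fun t => ⟨σ t, hσ t⟩, by fun_prop⟩, rfl⟩
    · rintro _ ⟨σ, rfl⟩ t
      exact (σ t).2
  have hbd (n) (c : SingularChains A (n + 1)) : f n (boundary n c) = boundary n (f (n + 1) c) := by
    suffices h : f n ∘ₗ boundary n = boundary n ∘ₗ f (n + 1) from LinearMap.congr_fun h c
    refine Finsupp.lhom_ext' fun σ => LinearMap.ext_ring ?_
    simp [f, boundary_single, Finsupp.mapDomain_single, face,
      ContinuousMap.comp_assoc]
  have hcyc (c : SingularChains A n) : f n c ∈ cycles X n ↔ c ∈ cycles A n := by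
    cases n with
    | zero => exact iff_of_true trivial trivial
    | succ n =>
      rw [mem_cycles_succ, mem_cycles_succ, ← hbd]
      exact map_eq_zero_iff _ (hinj n)
  constructor
  · intro h c hc hcc
    rw [hchains] at hc ⊢
    obtain ⟨c, rfl⟩ := hc
    obtain ⟨b, rfl⟩ := h c ((hcyc c).1 hcc)
    exact ⟨f (n + 1) b, ⟨b, rfl⟩, (hbd n b).symm⟩
  · intro h c hc
    obtain ⟨b, hb, hbc⟩ := h (f n c) (by rw [hchains]; exact ⟨c, rfl⟩) ((hcyc c).2 hc)
    rw [hchains] at hb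
    obtain ⟨b, rfl⟩ := hb
    exact ⟨b, hinj n (by rw [hbd, hbc])⟩

end Comparison

/-! ### The equivalence -/

theorem conditionA_iff_conditionB {X : Type u} [TopologicalSpace X] {S : Type v} {U : S → Set X}
    (hU : IsExcisive U) (k : ℕ) : ConditionA U k ↔ ConditionB U k := by
  have hA {θ : Finset S} (hθ : θ.Nonempty) : IsAcyclic (⋂ a ∈ θ, U a) ↔
      (θ.inf' hθ fun a => simplicesIn (U a)).Acyclic := by
    rw [isAcyclic_iff, simplicesIn_iInter hθ]
  have hB {θ : Finset S} (hθ : θ.Nonempty) : IsAcyclic (⋃ a ∈ θ, U a) ↔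
      (θ.sup' hθ fun a => simplicesIn (U a)).Acyclic := by
    rw [isAcyclic_iff, acyclic_sup_iff hθ (hU θ)]
  constructor
  · intro h θ hθ hk
    rw [hB hθ]
    exact sup'_of_forall_inf' (p := SimplexFamily.Acyclic) (fun _ _ => .sup) hθ _
      fun η hη hs => (hA hη).1 (h η hη ((Finset.card_le_card hs).trans hk))
  · intro h θ hθ hk
    rw [hA hθ]
    exact inf'_of_forall_sup' (p := SimplexFamily.Acyclic) (fun _ _ => .inf) hθ _
      fun η hη hs => (hB hη).1 (h η hη ((Finset.card_le_card hs).trans hk))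

end ExcisiveFamily

end

theorem theorem5 {X : Type u} [TopologicalSpace X] {S : Type v} (U : S → Set X)
    (hU : ExcisiveFamily.IsExcisive U) (k : ℕ) :
    ExcisiveFamily.ConditionA U k ↔ ExcisiveFamily.ConditionB U k :=
  ExcisiveFamily.conditionA_iff_conditionB hU k
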